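/- Let $\mathcal G$ be a weighted digraph on $n$ agents with adjacency matrix $A=(a_{ij})$, $a_{ij}\ge 0$, $a_{ii}=0$ (there is a link from agent $j$ to agent $i$ iff $a_{ij}>0$), and Laplacian $L=\mathrm{diag}\big(\sum_j a_{1j},\dots,\sum_j a_{nj}\big)-A$. Assume that $\mathcal G$ is strongly connected, and let $\xi\in\mathbb R^n$ be the vector with $\xi_i\ge 0$, $\sum_i\xi_i=1$ and $\xi^\top L=0$. Let $h>0$ and let $g(s)=(g_1(s_1),\dots,g_p(s_p))$ for $s\in\mathbb R^p$, where every $g_l:\mathbb R\to\mathbb R$ is continuous, nondecreasing on $\mathbb R$, strictly increasing on $[-h,h]$, Lipschitz on every compact set, and satisfies $g_l(s)=0$ iff $s=0$. Let $\alpha_i>0$, $\beta_i>0$ for $i=1,\dots,n$. Consider the agents $\dot x_i(t)=u_i(t)$, $x_i(t)\in\mathbb R^p$, with the event-triggered protocol $$u_i(t)=-\sum_{j=1}^n L_{ij}\,g\big(x_j(t^j_{k_j(t)})\big),\qquad k_j(t)=\max\{k: t^j_k\le t\},$$ where $t^i_1=0$ and $$t^i_{k+1}=\max\Big\{r\ge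 t^i_k:\ \big\|g(x_i(t^i_k))-g(x_i(t))\big\|^2\le \alpha_i e^{-\beta_i t}\ \text{ for all } t\in[t^i_k,r]\Big\},$$ with $t^i_{k+1}=\infty$ (agent $i$ does not trigger again) if the inequality is never about to be violated. The closed loop is run from an arbitrary initial state up to the first time, if any, at which the triggering times of some agent accumulate. Put $\bar x(t)=\sum_i\xi_i x_i(t)$. Then: (i) there is no Zeno behaviour: the closed loop runs on all of $[0,\infty)$ and every agent triggers only finitely many times in every bounded time interval; (ii) if $|\bar x_l(0)|\le h$ for every $l=1,\dots,p$, then $\lim_{t\to\infty}x_i(t)=\bar x(0)$ for every $i$, i.e. consensus is achieved with consensus value $\bar x(0)$. -/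

import Mathlib

namespace EventTriggered

open Set

/-- A weighted digraph on the agents `0, …, n-1`: `weight i j > 0` iff there is a link from
agent `j` to agent `i`. -/
structure WeightedDigraph (n : ℕ) where
  weight : Matrix (Fin n) (Fin n) ℝ
  weight_nonneg : ∀ i j, 0 ≤ weight i j
  weight_self : ∀ i, weight i i = 0

namespace WeightedDigraph

variable {n : ℕ}

/-- There is a link from `i` to `j`. -/
def Link (G : WeightedDigraph n) (i j : Fin n) : Prop := 0 < G.weight j i

/-- Any agent can be reached from any other one along directed links. -/
def StronglyConnected (G : WeightedDigraph n) : Prop :=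
  ∀ i j, i ≠ j → Relation.TransGen G.Link i j

/-- In-degree of agent `i`. -/
def inDegree (G : WeightedDigraph n) (i : Fin n) : ℝ := ∑ j, G.weight i j

/-- The Laplacian: in-degree matrix minus adjacency matrix. -/
def laplacian (G : WeightedDigraph n) : Matrix (Fin n) (Fin n) ℝ :=
  Matrix.diagonal G.inDegree - G.weight

/-- `ξ` is a nonnegative left null vector of the Laplacian whose entries sum to one. -/
structure IsLeftWeight (G : WeightedDigraph n) (ξ : Fin n → ℝ) : Prop where
  nonneg : ∀ i, 0 ≤ ξ i
  sum_eq_one : ∑ i, ξ i = 1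
  vecMul_laplacian : Matrix.vecMul ξ G.laplacian = 0

end WeightedDigraph

/-- The assumptions on the scalar output functions `g_1, …, g_p`. -/
structure OutputAssumption {p : ℕ} (g : Fin p → ℝ → ℝ) (h : ℝ) : Prop where
  continuous : ∀ l, Continuous (g l)
  monotone : ∀ l, Monotone (g l)
  strictMonoOn : ∀ l, StrictMonoOn (g l) (Icc (-h) h)
  eq_zero_iff : ∀ l s, g l s = 0 ↔ s = 0
  locallyLipschitz : ∀ l (S : Set ℝ), IsCompact S → ∃ K : NNReal, LipschitzOnWith K (g l) S

variable {n p : ℕ}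

/-- The componentwise output map `s ↦ (g_1 (s_1), …, g_p (s_p))` of `ℝ^p`. -/
noncomputable def output (g : Fin p → ℝ → ℝ) (s : EuclideanSpace ℝ (Fin p)) :
    EuclideanSpace ℝ (Fin p) :=
  WithLp.toLp 2 (fun l => g l (s l))

/-- The index of the last triggering time not after `τ`: the largest `k` with `t_k ≤ τ`. -/
noncomputable def lastIndex (t : ℕ → EReal) (τ : ℝ) : ℕ :=
  sSup {k : ℕ | t k ≤ (τ : EReal)}

/-- The state of an agent at its last triggering time not after `τ`. -/
noncomputable def sampledState (x : ℝ → EuclideanSpace ℝ (Fin p)) (t : ℕ → EReal) (τ : ℝ) :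
    EuclideanSpace ℝ (Fin p) :=
  x (t (lastIndex t τ)).toReal

/-- The event-triggered input `u_i(τ) = - ∑ j, L_ij g(x_j(t^j_{k_j(τ)}))`. -/
noncomputable def controlInput (G : WeightedDigraph n) (g : Fin p → ℝ → ℝ)
    (x : Fin n → ℝ → EuclideanSpace ℝ (Fin p)) (t : Fin n → ℕ → EReal) (i : Fin n) (τ : ℝ) :
    EuclideanSpace ℝ (Fin p) :=
  -∑ j, G.laplacian i j • output g (sampledState (x j) (t j) τ)

/-- The first time at which the triggering times of some agent accumulate, and `⊤` if this never
happens. The closed loop runs on `[0, horizon t)`; beyond it the index of the last triggering time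
of some agent makes no sense. -/
noncomputable def horizon (t : Fin n → ℕ → EReal) : EReal := ⨅ i, ⨆ k, t i k

/-- The times `r ∈ [s, T)` such that an agent with trajectory `y` that triggered at time `s`, and
has held the output `g (y s)` since then, satisfies `‖e(τ)‖² ≤ a e^{-b τ}` on all of `[s, r]`. -/
def admissibleTimes (g : Fin p → ℝ → ℝ) (a b : ℝ) (T : EReal)
    (y : ℝ → EuclideanSpace ℝ (Fin p)) (s : ℝ) : Set ℝ :=
  {r | s ≤ r ∧ (r : EReal) < T ∧
    ∀ τ ∈ Icc s r, ‖output g (y s) - output g (y τ)‖ ^ 2 ≤ a * Real.exp (-b * τ)}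

/-- `x` (states) and `t` (triggering times, numbered from `0`) form an execution of the closed
loop, run up to the first accumulation of triggering times. The value `t i k = ⊤` means that agent
`i` triggers at most `k` times. Nothing is required of `x` outside `[0, horizon t)`, and no limit at
`horizon t` is presupposed.

As the input is piecewise constant and right continuous, `ẋ_i = u_i` is stated as a right
derivative at every time, together with continuity of `x_i`. -/
structure IsExecution (G : WeightedDigraph n) (g : Fin p → ℝ → ℝ) (α β : Fin n → ℝ)
    (x : Fin n → ℝ → EuclideanSpace ℝ (Fin p)) (t : Fin n → ℕ → EReal) : Prop where
  first : ∀ i, t i 0 = 0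
  /-- The next triggering time is the largest admissible time; if the inequality is never about
  to be violated, there is none. -/
  next : ∀ i k (s : ℝ), t i k = (s : EReal) →
    (∃ r : ℝ, IsGreatest (admissibleTimes g (α i) (β i) (horizon t) (x i) s) r ∧
      t i (k + 1) = (r : EReal)) ∨
    ((∀ r : ℝ, s ≤ r → (r : EReal) < horizon t →
      r ∈ admissibleTimes g (α i) (β i) (horizon t) (x i) s) ∧ t i (k + 1) = ⊤)
  next_top : ∀ i k, t i k = ⊤ → t i (k + 1) = ⊤
  continuousOn : ∀ i, ContinuousOn (x i) {τ : ℝ | 0 ≤ τ ∧ (τ : EReal) < horizon t}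
  deriv_right : ∀ i (τ : ℝ), 0 ≤ τ → (τ : EReal) < horizon t →
    HasDerivWithinAt (x i) (controlInput G g x t i τ) (Ici τ) τ

/-- No Zeno behaviour: the closed loop runs for all times, and each agent triggers only finitely
often in bounded time. -/
def NoZeno (t : Fin n → ℕ → EReal) : Prop :=
  horizon t = ⊤ ∧ ∀ i (S : ℝ), {k : ℕ | t i k ≤ (S : EReal)}.Finite

/-- The weighted average `∑ i, ξ_i x_i(τ)`. -/
noncomputable def weightedAverage (ξ : Fin n → ℝ) (x : Fin n → ℝ → EuclideanSpace ℝ (Fin p))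
    (τ : ℝ) : EuclideanSpace ℝ (Fin p) :=
  ∑ i, ξ i • x i τ

end EventTriggered

/-!
Each coordinate of the states follows a consensus dynamics `y' = -L (f(y) + e)` whose error `e` is
bounded by an integrable envelope `ε`. At an agent with maximal state the term `-L f(y)` does not
push upwards, so the states grow by at most `‖L‖ ∫ ε` and stay bounded. Hence the velocities are
bounded and the outputs uniformly continuous in time. Since the triggering threshold is bounded
below on a bounded time interval, the time between two triggerings is bounded below as well, and the
triggering times cannot accumulate.

Along the flow the Lyapunov function `∑ i, ξ_i ∫₀^{y_i} f` decreases at half the rate of the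
disagreement `∑ i j, ξ_i a_ij (f(y_i) - f(y_j))²`, up to an integrable error, so by Barbalat's
argument the disagreement tends to `0`. The states at a cluster point of `y` therefore have equal
outputs, and their weighted average is the conserved value `ξ ⬝ᵥ y 0`. Were they not all equal to
this average, some would lie strictly above and some strictly below it, and the corresponding
outputs would differ, because `f` increases strictly across the average.
-/

open Set Filter Topology MeasureTheory
open scoped Matrix Matrix.Norms.Operator

theorem forall_le_of_deriv_right_lt_deriv_boundary {ι : Type*} [Finite ι] {y y' : ℝ → ι → ℝ}
    {B B' : ℝ → ℝ} {a b : ℝ}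
    (hy : ContinuousOn y (Icc a b)) (hy' : ∀ τ ∈ Ico a b, HasDerivWithinAt y (y' τ) (Ici τ) τ)
    (ha : ∀ i, y a i ≤ B a) (hB : ContinuousOn B (Icc a b))
    (hB' : ∀ τ ∈ Ico a b, HasDerivWithinAt B (B' τ) (Ici τ) τ)
    (bound : ∀ τ ∈ Ico a b, ∀ i, (∀ j, y τ j ≤ B τ) → y τ i = B τ → y' τ i < B' τ) :
    ∀ τ ∈ Icc a b, ∀ i, y τ i ≤ B τ := by
  refine IsClosed.Icc_subset_of_forall_mem_nhdsWithin (s := {τ | ∀ i, y τ i ≤ B τ}) ?_ ha ?_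
  · have hclosed (i : ι) : IsClosed {τ ∈ Icc a b | y τ i ≤ B τ} :=
      isClosed_Icc.isClosed_le ((continuous_apply i).comp_continuousOn hy) hB
    have hset : {τ | ∀ i, y τ i ≤ B τ} ∩ Icc a b =
        Icc a b ∩ ⋂ i, {τ ∈ Icc a b | y τ i ≤ B τ} := by
      ext τ
      simp only [mem_inter_iff, mem_ofPred_eq, mem_iInter]
      exact ⟨fun h => ⟨h.2, fun i => ⟨h.2, h.1 i⟩⟩, fun h => ⟨fun i => (h.2 i).2, h.1⟩⟩
    exact hset ▸ isClosed_Icc.inter (isClosed_iInter hclosed)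
  · rintro τ ⟨hle, hτ⟩
    refine eventually_all.2 fun i => ?_
    have hd : HasDerivWithinAt (fun σ => y σ i - B σ) (y' τ i - B' τ) (Ici τ) τ :=
      (hasDerivWithinAt_pi.1 (hy' τ hτ) i).sub (hB' τ hτ)
    rcases (hle i).lt_or_eq with hlt | heq
    · filter_upwards [(hd.continuousWithinAt.mono Ioi_subset_Ici_self).eventually_lt_const
        (sub_neg.2 hlt)] with σ hσ
      exact (sub_neg.1 hσ).le
    · have hslope := hd.limsup_slope_le (sub_neg.2 (bound τ hτ i hle heq))
      rw [Ici_sdiff_left] at hslope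
      filter_upwards [hslope, self_mem_nhdsWithin] with σ hσ hτσ
      rw [slope_def_field, heq, sub_self, sub_zero] at hσ
      have hpos : 0 < σ - τ := sub_pos.2 hτσ
      exact (sub_neg.1 (by simpa only [zero_mul] using (div_lt_iff₀ hpos).1 hσ)).le

theorem tendsto_zero_of_deriv_right_le_neg {U U' q : ℝ → ℝ} {a : ℝ} (hU : ContinuousOn U (Ici a))
    (hU' : ∀ τ ∈ Ici a, HasDerivWithinAt U (U' τ) (Ici τ) τ) (hle : ∀ τ ∈ Ici a, U' τ ≤ -q τ)
    (hbdd : BddBelow (U '' Ici a)) (hq₀ : ∀ τ ∈ Ici a, 0 ≤ q τ)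
    (hq : UniformContinuousOn q (Ici a)) : Tendsto q atTop (𝓝 0) := by
  have decay {s r c : ℝ} (hs : a ≤ s) (hsr : s ≤ r) (hc : ∀ τ ∈ Ico s r, c ≤ q τ) :
      U r ≤ U s - c * (r - s) := by
    refine image_le_of_deriv_right_le_deriv_boundary (B := fun τ => U s - c * (τ - s))
      (B' := fun _ => -c) (hU.mono fun τ hτ => hs.trans hτ.1)
      (fun τ hτ => hU' τ (hs.trans hτ.1)) (by simp) (by fun_prop) (fun τ _ => ?_)
      (fun τ hτ => ?_) ⟨hsr, le_rfl⟩
    · simpa using ((((hasDerivAt_id τ).sub_const s).const_mul c).const_sub (U s)).hasDerivWithinAt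
    · linarith [hle τ (hs.trans hτ.1), hc τ hτ]
  rw [Metric.tendsto_atTop]
  intro η hη
  obtain ⟨δ, hδ, hqδ⟩ := Metric.uniformContinuousOn_iff_le.1 hq (η / 2) (half_pos hη)
  obtain ⟨_, ⟨s₀, hs₀, rfl⟩, hlt⟩ := exists_lt_of_csInf_lt (nonempty_Ici.image U)
    (lt_add_of_pos_right (sInf (U '' Ici a)) (by positivity : 0 < η / 2 * δ))
  refine ⟨s₀, fun s hs => ?_⟩
  have has : a ≤ s := le_trans hs₀ hs
  rw [Real.dist_eq, sub_zero, abs_of_nonneg (hq₀ s has)]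
  by_contra! hqs
  have hqhalf : ∀ τ ∈ Ico s (s + δ), η / 2 ≤ q τ := fun τ hτ => by
    have hdist := hqδ τ (has.trans hτ.1) s has <| by
      rw [Real.dist_eq, abs_of_nonneg (sub_nonneg.2 hτ.1)]
      linarith [hτ.2]
    rw [Real.dist_eq] at hdist
    linarith [(abs_le.1 hdist).1]
  have hdrop : U (s + δ) ≤ U s - η / 2 * δ := by
    simpa using decay has (le_add_of_nonneg_right hδ.le) hqhalf
  have hanti : U s ≤ U s₀ := by
    simpa using decay hs₀ hs fun τ hτ => hq₀ τ (le_trans hs₀ hτ.1)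
  have hinf : sInf (U '' Ici a) ≤ U (s + δ) :=
    csInf_le hbdd ⟨s + δ, has.trans (le_add_of_nonneg_right hδ.le), rfl⟩
  linarith

theorem eq_of_mapClusterPt_of_tendsto_comp {X Y α : Type*} [TopologicalSpace X]
    [TopologicalSpace Y] [T2Space Y] {l : Filter α} {u : α → X} {φ : X → Y} {z : X} {c : Y}
    (hφ : ContinuousAt φ z) (hz : MapClusterPt z l u) (hc : Tendsto (φ ∘ u) l (𝓝 c)) :
    φ z = c := by
  obtain ⟨𝓤, h𝓤, hlim⟩ := mapClusterPt_iff_ultrafilter.1 hz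
  exact tendsto_nhds_unique (hφ.tendsto.comp hlim) (hc.mono_left h𝓤)

theorem eq_of_sum_mul_eq_of_forall_le {ι : Type*} [Fintype ι] {ξ z : ι → ℝ} {c : ℝ}
    (hξ : ∀ i, 0 < ξ i) (hξ₁ : ∑ i, ξ i = 1) (hz : ∑ i, ξ i * z i = c) (hle : ∀ i, z i ≤ c)
    (i : ι) : z i = c := by
  have hsum : ∑ i, ξ i * z i = ∑ i, ξ i * c := by rw [hz, ← Finset.sum_mul, hξ₁, one_mul]
  exact mul_left_cancel₀ (hξ i).ne' <| (Finset.sum_eq_sum_iff_of_le fun i _ =>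
    mul_le_mul_of_nonneg_left (hle i) (hξ i).le).1 hsum i (Finset.mem_univ i)

namespace EventTriggered

/-- `c` is a point of increase of `f`: for monotone `f` on the reals, `c` is not interior to an
interval of constancy of `f`, but may be an endpoint of one. At such a `c`, agreement of the outputs
of agents whose average state is `c` forces agreement of their states. -/
def IsIncreasePoint {α β : Type*} [LT α] [LT β] (f : α → β) (c : α) : Prop :=
  ∀ ⦃a b⦄, a < c → c < b → f a < f b

theorem isIncreasePoint_of_strictMonoOn_Icc {α β : Type*} [LinearOrder α] [Preorder β] {f : α → β}
    {a b c : α} (hab : a < b) (hf : Monotone f) (hs : StrictMonoOn f (Icc a b))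
    (hc : c ∈ Icc a b) : IsIncreasePoint f c := fun s r hsc hcr => by
  have hlt : max s a < min r b :=
    max_lt (lt_min (hsc.trans hcr) (hsc.trans_le hc.2)) (lt_min (hc.1.trans_lt hcr) hab)
  calc f s ≤ f (max s a) := hf (le_max_left s a)
    _ < f (min r b) := hs ⟨le_max_right s a, hlt.le.trans (min_le_right r b)⟩
      ⟨(le_max_right s a).trans hlt.le, min_le_right r b⟩ hlt
    _ ≤ f r := hf (min_le_left r b)

theorem IsIncreasePoint.eq_of_sum_mul_eq {ι : Type*} [Fintype ι] {f : ℝ → ℝ} {ξ z : ι → ℝ} {c : ℝ}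
    (hf : IsIncreasePoint f c) (hξ : ∀ i, 0 < ξ i) (hξ₁ : ∑ i, ξ i = 1)
    (hz : ∑ i, ξ i * z i = c) (hfz : ∀ i j, f (z i) = f (z j)) (i : ι) : z i = c := by
  by_cases hle : ∀ j, z j ≤ c
  · exact eq_of_sum_mul_eq_of_forall_le hξ hξ₁ hz hle i
  · obtain ⟨k, hk⟩ := not_forall.1 hle
    have hge (j : ι) : c ≤ z j := not_lt.1 fun hj => (hf hj (not_le.1 hk)).ne (hfz j k)
    refine neg_injective <| eq_of_sum_mul_eq_of_forall_le (z := fun i => -z i) hξ hξ₁ ?_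
      (fun j => neg_le_neg (hge j)) i
    simp only [mul_neg, Finset.sum_neg_distrib, hz]

variable {n p : ℕ}

namespace WeightedDigraph

variable {G : WeightedDigraph n}

theorem StronglyConnected.forall_of_link (hG : G.StronglyConnected) {P : Fin n → Prop} {i : Fin n}
    (hi : P i) (hP : ∀ j k, G.Link j k → P j → P k) (j : Fin n) : P j := by
  rcases eq_or_ne i j with rfl | hij
  · exact hi
  · exact Relation.TransGen.head_induction_on (motive := fun a _ => P a → P j) (hG i j hij)
      (fun hlink => hP _ _ hlink) (fun hlink _ ih hj => ih (hP _ _ hlink hj)) hi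

theorem laplacian_mulVec_apply (G : WeightedDigraph n) (v : Fin n → ℝ) (i : Fin n) :
    (G.laplacian *ᵥ v) i = ∑ j, G.weight i j * (v i - v j) := by
  rw [laplacian, Matrix.sub_mulVec, Pi.sub_apply, Matrix.mulVec_diagonal]
  simp only [inDegree, Finset.sum_mul, mul_sub, Finset.sum_sub_distrib, Matrix.mulVec, dotProduct]

theorem laplacian_mulVec_nonneg {v : Fin n → ℝ} {i : Fin n} (hv : ∀ j, v j ≤ v i) :
    0 ≤ (G.laplacian *ᵥ v) i := by
  rw [laplacian_mulVec_apply]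
  exact Finset.sum_nonneg fun j _ => mul_nonneg (G.weight_nonneg i j) (sub_nonneg.2 (hv j))

/-- The disagreement `∑ i j, ξ_i a_ij (u_i - u_j)²` of the values `u`: twice the rate at which the
unperturbed consensus dynamics dissipates the Lyapunov function. -/
def disagreement (G : WeightedDigraph n) (ξ u : Fin n → ℝ) : ℝ :=
  ∑ i, ξ i * ∑ j, G.weight i j * (u i - u j) ^ 2

theorem continuous_disagreement (G : WeightedDigraph n) (ξ : Fin n → ℝ) :
    Continuous (G.disagreement ξ) := by
  unfold disagreement
  fun_prop

namespace IsLeftWeight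

variable {ξ : Fin n → ℝ}

theorem dotProduct_laplacian_mulVec (hξ : G.IsLeftWeight ξ) (v : Fin n → ℝ) :
    ξ ⬝ᵥ (G.laplacian *ᵥ v) = 0 := by
  rw [Matrix.dotProduct_mulVec, hξ.vecMul_laplacian, zero_dotProduct]

theorem sum_mul_weight (hξ : G.IsLeftWeight ξ) (j : Fin n) :
    ∑ i, ξ i * G.weight i j = ξ j * G.inDegree j := by
  have hj := congrFun hξ.vecMul_laplacian j
  rw [laplacian, Matrix.vecMul_sub, Pi.sub_apply, Matrix.vecMul_diagonal] at hj
  exact (sub_eq_zero.1 hj).symm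

theorem pos (hξ : G.IsLeftWeight ξ) (hG : G.StronglyConnected) (i : Fin n) : 0 < ξ i := by
  refine (hξ.nonneg i).lt_of_ne' fun hi => ?_
  have hzero : ∀ j, ξ j = 0 := hG.forall_of_link hi fun j k hjk hj => by
    have hsum := hξ.sum_mul_weight j
    rw [hj, zero_mul, Finset.sum_eq_zero_iff_of_nonneg
      fun m _ => mul_nonneg (hξ.nonneg m) (G.weight_nonneg m j)] at hsum
    exact (mul_eq_zero.1 (hsum k (Finset.mem_univ k))).resolve_right (ne_of_gt hjk)
  simpa [hzero] using hξ.sum_eq_one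

theorem sum_mul_le (hξ : G.IsLeftWeight ξ) {z : Fin n → ℝ} {c : ℝ} (hz : ∀ i, z i ≤ c) :
    ∑ i, ξ i * z i ≤ c :=
  calc ∑ i, ξ i * z i ≤ ∑ i, ξ i * c :=
        Finset.sum_le_sum fun i _ => mul_le_mul_of_nonneg_left (hz i) (hξ.nonneg i)
    _ = c := by rw [← Finset.sum_mul, hξ.sum_eq_one, one_mul]

theorem disagreement_nonneg (hξ : G.IsLeftWeight ξ) (u : Fin n → ℝ) : 0 ≤ G.disagreement ξ u :=
  Finset.sum_nonneg fun i _ => mul_nonneg (hξ.nonneg i) <|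
    Finset.sum_nonneg fun j _ => mul_nonneg (G.weight_nonneg i j) (sq_nonneg _)

theorem eq_of_disagreement_eq_zero (hξ : G.IsLeftWeight ξ) (hG : G.StronglyConnected)
    {u : Fin n → ℝ} (hu : G.disagreement ξ u = 0) (i j : Fin n) : u i = u j := by
  have hterm (k m : Fin n) : 0 ≤ G.weight k m * (u k - u m) ^ 2 :=
    mul_nonneg (G.weight_nonneg k m) (sq_nonneg _)
  refine hG.forall_of_link (P := fun k => u i = u k) rfl (fun m k hmk him => him.trans ?_) j
  have hk : ∑ m, G.weight k m * (u k - u m) ^ 2 = 0 :=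
    (mul_eq_zero.1 ((Finset.sum_eq_zero_iff_of_nonneg fun k _ => mul_nonneg (hξ.nonneg k)
      (Finset.sum_nonneg fun m _ => hterm k m)).1 hu k (Finset.mem_univ k))).resolve_left
      (hξ.pos hG k).ne'
  have hkm := (Finset.sum_eq_zero_iff_of_nonneg fun m _ => hterm k m).1 hk m (Finset.mem_univ m)
  exact (sub_eq_zero.1 (pow_eq_zero_iff two_ne_zero |>.1
    ((mul_eq_zero.1 hkm).resolve_left (ne_of_gt hmk)))).symm

theorem two_mul_sum_mul_laplacian_mulVec (hξ : G.IsLeftWeight ξ) (u : Fin n → ℝ) :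
    2 * ∑ i, ξ i * (u i * (G.laplacian *ᵥ u) i) = G.disagreement ξ u := by
  have hsq := hξ.dotProduct_laplacian_mulVec fun i => u i ^ 2
  rw [← sub_eq_zero, ← hsq]
  simp only [disagreement, dotProduct, laplacian_mulVec_apply, Finset.mul_sum,
    ← Finset.sum_sub_distrib]
  exact Finset.sum_congr rfl fun i _ => Finset.sum_congr rfl fun j _ => by ring

theorem two_mul_sum_mul_neg_laplacian_mulVec_add_le (hξ : G.IsLeftWeight ξ) (u v : Fin n → ℝ) :
    2 * ∑ i, ξ i * (u i * -(G.laplacian *ᵥ (u + v)) i) ≤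
      -G.disagreement ξ u + 2 * (‖u‖ * (‖G.laplacian‖ * ‖v‖)) := by
  have hperturb : ∑ i, ξ i * (u i * -(G.laplacian *ᵥ v) i) ≤ ‖u‖ * (‖G.laplacian‖ * ‖v‖) :=
    hξ.sum_mul_le fun i =>
      calc u i * -(G.laplacian *ᵥ v) i ≤ ‖u i‖ * ‖(G.laplacian *ᵥ v) i‖ := by
            rw [← norm_neg ((G.laplacian *ᵥ v) i), ← norm_mul]
            exact Real.le_norm_self _
        _ ≤ ‖u‖ * (‖G.laplacian‖ * ‖v‖) := by
            gcongr
            · exact norm_le_pi_norm u i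
            · exact (norm_le_pi_norm _ i).trans (Matrix.linfty_opNorm_mulVec _ _)
  have hsplit : ∑ i, ξ i * (u i * -(G.laplacian *ᵥ (u + v)) i) =
      -(∑ i, ξ i * (u i * (G.laplacian *ᵥ u) i)) + ∑ i, ξ i * (u i * -(G.laplacian *ᵥ v) i) := by
    rw [← Finset.sum_neg_distrib, ← Finset.sum_add_distrib]
    refine Finset.sum_congr rfl fun i _ => ?_
    rw [Matrix.mulVec_add, Pi.add_apply]
    ring
  rw [hsplit, ← hξ.two_mul_sum_mul_laplacian_mulVec u]
  linarith

end IsLeftWeight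

end WeightedDigraph

section PerturbedFlow

/-- The time interval `[0, T)`, where `T = ⊤` is allowed. -/
def timeDomain (T : EReal) : Set ℝ := {τ | 0 ≤ τ ∧ (τ : EReal) < T}

theorem timeDomain_top : timeDomain ⊤ = Ici 0 := by
  ext τ
  simp only [timeDomain, mem_ofPred_eq, EReal.coe_lt_top, and_true, mem_Ici]

theorem Icc_subset_timeDomain {T : EReal} {σ τ : ℝ} (hσ : 0 ≤ σ) (hτ : τ ∈ timeDomain T) :
    Icc σ τ ⊆ timeDomain T := fun _ hs =>
  ⟨hσ.trans hs.1, (EReal.coe_le_coe_iff.2 hs.2).trans_lt hτ.2⟩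

/-- A bound on the sampling errors under which they perturb the consensus dynamics by a bounded
velocity and a finite total displacement. -/
structure IsErrorEnvelope (ε : ℝ → ℝ) : Prop where
  continuous : Continuous ε
  nonneg : ∀ τ, 0 ≤ ε τ
  bddAbove : BddAbove (ε '' Ici 0)
  integrableOn : IntegrableOn ε (Ioi 0)

/-- `y` solves the consensus dynamics `y' = -L (f(y) + e)` on `[0, T)`, where each agent perturbs
the output `f (y i)` that it transmits by an error `e i` with `|e i| ≤ ε`. As in `IsExecution`,
the derivative is a right derivative, because `e` may jump. -/
structure IsPerturbedFlow (G : WeightedDigraph n) (f ε : ℝ → ℝ) (T : EReal)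
    (y e : ℝ → Fin n → ℝ) : Prop where
  continuousOn : ContinuousOn y (timeDomain T)
  deriv_right : ∀ τ ∈ timeDomain T,
    HasDerivWithinAt y (-(G.laplacian *ᵥ (f ∘ y τ + e τ))) (Ici τ) τ
  norm_error_le : ∀ τ ∈ timeDomain T, ‖e τ‖ ≤ ε τ

variable {ε : ℝ → ℝ} {T : EReal} {τ : ℝ}

theorem IsErrorEnvelope.integral_le (hε : IsErrorEnvelope ε) (hτ : 0 ≤ τ) :
    ∫ s in 0..τ, ε s ≤ ∫ s in Ioi 0, ε s := by
  rw [intervalIntegral.integral_of_le hτ]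
  exact setIntegral_mono_set hε.integrableOn (ae_of_all _ hε.nonneg)
    Ioc_subset_Ioi_self.eventuallyLE

namespace IsPerturbedFlow

variable {G : WeightedDigraph n} {f : ℝ → ℝ} {y e : ℝ → Fin n → ℝ}

theorem neg (hy : IsPerturbedFlow G f ε T y e) :
    IsPerturbedFlow G (fun s => -f (-s)) ε T (-y) (-e) where
  continuousOn := hy.continuousOn.neg
  deriv_right τ hτ := by
    have houtput : (fun s => -f (-s)) ∘ (-y) τ + (-e) τ = -(f ∘ y τ + e τ) := by
      ext i
      simp only [Pi.add_apply, Pi.neg_apply, Function.comp_apply, neg_neg, neg_add]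
    rw [houtput, Matrix.mulVec_neg]
    exact (hy.deriv_right τ hτ).neg
  norm_error_le τ hτ := (norm_neg (e τ)).trans_le (hy.norm_error_le τ hτ)

theorem apply_le (hy : IsPerturbedFlow G f ε T y e) (hf : Monotone f) (hε : Continuous ε)
    (hτ : τ ∈ timeDomain T) (i : Fin n) :
    y τ i ≤ ‖y 0‖ + ‖G.laplacian‖ * ∫ s in 0..τ, ε s := by
  refine le_of_forall_pos_le_add fun δ hδ => ?_
  -- The margin `δ e^(σ - τ)` makes the comparison strict at every time and equals `δ` at `τ`.
  have hB (σ : ℝ) : HasDerivAt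
      (fun σ => ‖y 0‖ + ‖G.laplacian‖ * (∫ s in 0..σ, ε s) + δ * Real.exp (σ - τ))
      (‖G.laplacian‖ * ε σ + δ * Real.exp (σ - τ)) σ := by
    simpa using (((hε.integral_hasStrictDerivAt 0 σ).hasDerivAt.const_mul ‖G.laplacian‖).const_add
      ‖y 0‖).fun_add ((((hasDerivAt_id σ).sub_const τ).exp).const_mul δ)
  have hsub := Icc_subset_timeDomain le_rfl hτ
  have hbound := forall_le_of_deriv_right_lt_deriv_boundary (hy.continuousOn.mono hsub)
    (fun σ hσ => hy.deriv_right σ (hsub ⟨hσ.1, hσ.2.le⟩)) (fun j => ?_)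
    (fun σ _ => (hB σ).continuousAt.continuousWithinAt) (fun σ _ => (hB σ).hasDerivWithinAt)
    (fun σ hσ j hle heq => ?_) τ ⟨hτ.1, le_rfl⟩ i
  · simpa using hbound
  · have hj : y 0 j ≤ ‖y 0‖ := (Real.le_norm_self _).trans (norm_le_pi_norm (y 0) j)
    simpa using hj.trans (le_add_of_nonneg_right (by positivity))
  · have houtput : 0 ≤ (G.laplacian *ᵥ (f ∘ y σ)) j :=
      WeightedDigraph.laplacian_mulVec_nonneg fun k => hf ((hle k).trans_eq heq.symm)
    have herror : -(G.laplacian *ᵥ e σ) j ≤ ‖G.laplacian‖ * ε σ :=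
      calc -(G.laplacian *ᵥ e σ) j ≤ ‖(G.laplacian *ᵥ e σ) j‖ := neg_le_abs _
        _ ≤ ‖G.laplacian *ᵥ e σ‖ := norm_le_pi_norm _ j
        _ ≤ ‖G.laplacian‖ * ‖e σ‖ := Matrix.linfty_opNorm_mulVec _ _
        _ ≤ ‖G.laplacian‖ * ε σ := by
          gcongr
          exact hy.norm_error_le σ (hsub ⟨hσ.1, hσ.2.le⟩)
    have hmargin : 0 < δ * Real.exp (σ - τ) := by positivity
    rw [Pi.neg_apply, Matrix.mulVec_add, Pi.add_apply]
    linarith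

theorem norm_le (hy : IsPerturbedFlow G f ε T y e) (hf : Monotone f) (hε : IsErrorEnvelope ε)
    (hτ : τ ∈ timeDomain T) : ‖y τ‖ ≤ ‖y 0‖ + ‖G.laplacian‖ * ∫ s in 0..τ, ε s := by
  refine (pi_norm_le_iff_of_nonneg (add_nonneg (norm_nonneg _) (mul_nonneg (norm_nonneg _)
    (intervalIntegral.integral_nonneg hτ.1 fun s _ => hε.nonneg s)))).2 fun i =>
    abs_le'.2 ⟨hy.apply_le hf hε.continuous hτ i, ?_⟩
  simpa using hy.neg.apply_le (fun _ _ hab => neg_le_neg (hf (neg_le_neg hab)))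
    hε.continuous hτ i

theorem exists_norm_le (hy : IsPerturbedFlow G f ε T y e) (hf : Monotone f)
    (hε : IsErrorEnvelope ε) : ∃ R, ∀ τ ∈ timeDomain T, ‖y τ‖ ≤ R :=
  ⟨‖y 0‖ + ‖G.laplacian‖ * ∫ s in Ioi 0, ε s, fun τ hτ => (hy.norm_le hf hε hτ).trans <| by
    gcongr
    exact hε.integral_le hτ.1⟩

theorem exists_norm_comp_le (hy : IsPerturbedFlow G f ε T y e) (hf : Monotone f)
    (hfc : Continuous f) (hε : IsErrorEnvelope ε) :
    ∃ F, ∀ τ ∈ timeDomain T, ‖f ∘ y τ‖ ≤ F := by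
  obtain ⟨R, hR⟩ := hy.exists_norm_le hf hε
  obtain ⟨F, hF⟩ := (isCompact_closedBall (0 : Fin n → ℝ) R).exists_bound_of_continuousOn
    (Pi.continuous_postcomp hfc).continuousOn
  exact ⟨F, fun τ hτ => hF _ (mem_closedBall_zero_iff.2 (hR τ hτ))⟩

theorem exists_lipschitzOnWith (hy : IsPerturbedFlow G f ε T y e) (hf : Monotone f)
    (hfc : Continuous f) (hε : IsErrorEnvelope ε) :
    ∃ K, LipschitzOnWith K y (timeDomain T) := by
  obtain ⟨F, hF⟩ := hy.exists_norm_comp_le hf hfc hε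
  obtain ⟨E, hE⟩ := hε.bddAbove
  have hspeed (τ : ℝ) (hτ : τ ∈ timeDomain T) :
      ‖-(G.laplacian *ᵥ (f ∘ y τ + e τ))‖ ≤ ‖G.laplacian‖ * (F + E) := by
    rw [norm_neg]
    refine (Matrix.linfty_opNorm_mulVec _ _).trans ?_
    gcongr
    exact (norm_add_le _ _).trans (add_le_add (hF τ hτ)
      ((hy.norm_error_le τ hτ).trans (hE ⟨τ, hτ.1, rfl⟩)))
  have hle {σ τ : ℝ} (hσ : σ ∈ timeDomain T) (hτ : τ ∈ timeDomain T) (hστ : σ ≤ τ) :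
      dist (y τ) (y σ) ≤ ‖G.laplacian‖ * (F + E) * dist τ σ := by
    have hsub := Icc_subset_timeDomain hσ.1 hτ
    rw [dist_eq_norm, Real.dist_eq, abs_of_nonneg (sub_nonneg.2 hστ)]
    exact norm_image_sub_le_of_norm_deriv_right_le_segment (hy.continuousOn.mono hsub)
      (fun s hs => hy.deriv_right s (hsub ⟨hs.1, hs.2.le⟩))
      (fun s hs => hspeed s (hsub ⟨hs.1, hs.2.le⟩)) τ ⟨hστ, le_rfl⟩
  refine ⟨(‖G.laplacian‖ * (F + E)).toNNReal, LipschitzOnWith.of_dist_le' ?_⟩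
  intro σ hσ τ hτ
  rcases le_total σ τ with hστ | hτσ
  · rw [dist_comm (y σ), dist_comm σ]
    exact hle hσ hτ hστ
  · exact hle hτ hσ hτσ

theorem uniformContinuousOn_comp {X : Type*} [UniformSpace X] {φ : (Fin n → ℝ) → X}
    (hy : IsPerturbedFlow G f ε T y e) (hf : Monotone f) (hfc : Continuous f)
    (hε : IsErrorEnvelope ε) (hφ : Continuous φ) :
    UniformContinuousOn (fun τ => φ (y τ)) (timeDomain T) := by
  obtain ⟨K, hK⟩ := hy.exists_lipschitzOnWith hf hfc hε
  obtain ⟨R, hR⟩ := hy.exists_norm_le hf hε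
  exact ((isCompact_closedBall (0 : Fin n → ℝ) R).uniformContinuousOn_of_continuous
    hφ.continuousOn).comp hK.uniformContinuousOn fun τ hτ => mem_closedBall_zero_iff.2 (hR τ hτ)

theorem dotProduct_eq {ξ : Fin n → ℝ} (hy : IsPerturbedFlow G f ε T y e) (hξ : G.IsLeftWeight ξ)
    (hτ : τ ∈ timeDomain T) : ξ ⬝ᵥ y τ = ξ ⬝ᵥ y 0 := by
  have hsub := Icc_subset_timeDomain le_rfl hτ
  refine constant_of_has_deriv_right_zero (f := fun σ => ξ ⬝ᵥ y σ) ?_ (fun σ hσ => ?_) τ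
    ⟨hτ.1, le_rfl⟩
  · have hdot : Continuous fun u : Fin n → ℝ => ξ ⬝ᵥ u := by fun_prop
    exact hdot.comp_continuousOn (hy.continuousOn.mono hsub)
  · have hd := hasDerivWithinAt_pi.1 (hy.deriv_right σ (hsub ⟨hσ.1, hσ.2.le⟩))
    have hsum := HasDerivWithinAt.fun_sum (u := Finset.univ) fun i _ => (hd i).const_mul (ξ i)
    have hzero := hξ.dotProduct_laplacian_mulVec (f ∘ y σ + e σ)
    rw [← neg_eq_zero, ← dotProduct_neg] at hzero
    exact hzero ▸ hsum

end IsPerturbedFlow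

/-- The Lyapunov function `∑ i, ξ_i ∫₀^{z_i} f` of the consensus dynamics with output `f`. -/
noncomputable def lyapunov (ξ : Fin n → ℝ) (f : ℝ → ℝ) (z : Fin n → ℝ) : ℝ :=
  ∑ i, ξ i * ∫ s in 0..z i, f s

theorem continuous_lyapunov {f : ℝ → ℝ} (hfc : Continuous f) (ξ : Fin n → ℝ) :
    Continuous (lyapunov ξ f) :=
  continuous_finsetSum _ fun i _ => continuous_const.mul <|
    (intervalIntegral.continuous_primitive (fun _ _ => hfc.intervalIntegrable _ _) 0).comp
      (continuous_apply i)

theorem hasDerivWithinAt_lyapunov_comp {f : ℝ → ℝ} (hfc : Continuous f) (ξ : Fin n → ℝ)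
    {y : ℝ → Fin n → ℝ} {y' : Fin n → ℝ} {S : Set ℝ} (hy : HasDerivWithinAt y y' S τ) :
    HasDerivWithinAt (fun σ => lyapunov ξ f (y σ)) (∑ i, ξ i * (f (y τ i) * y' i)) S τ :=
  HasDerivWithinAt.fun_sum fun i _ =>
    (HasDerivAt.comp_hasDerivWithinAt (h₂ := fun z => ∫ s in 0..z, f s) τ
      (hfc.integral_hasStrictDerivAt 0 (y τ i)).hasDerivAt
      (hasDerivWithinAt_pi.1 hy i)).const_mul (ξ i)

namespace IsPerturbedFlow

variable {G : WeightedDigraph n} {f : ℝ → ℝ} {ξ : Fin n → ℝ} {y e : ℝ → Fin n → ℝ}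

theorem tendsto_disagreement (hy : IsPerturbedFlow G f ε ⊤ y e) (hf : Monotone f)
    (hfc : Continuous f) (hε : IsErrorEnvelope ε) (hξ : G.IsLeftWeight ξ) :
    Tendsto (fun τ => G.disagreement ξ (f ∘ y τ)) atTop (𝓝 0) := by
  obtain ⟨F, hF⟩ := hy.exists_norm_comp_le hf hfc hε
  obtain ⟨R, hR⟩ := hy.exists_norm_le hf hε
  have hV := continuous_lyapunov hfc ξ
  have hq := hy.uniformContinuousOn_comp hf hfc hε
    ((G.continuous_disagreement ξ).comp (Pi.continuous_postcomp hfc))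
  have hyc := hy.continuousOn
  have hyd := hy.deriv_right
  have hye := hy.norm_error_le
  rw [timeDomain_top] at hF hR hq hyc hyd hye
  have hF₀ : 0 ≤ F := (norm_nonneg _).trans (hF 0 self_mem_Ici)
  have hI (τ : ℝ) : HasDerivAt (fun τ => ∫ s in 0..τ, ε s) (ε τ) τ :=
    (hε.continuous.integral_hasStrictDerivAt 0 τ).hasDerivAt
  refine tendsto_zero_of_deriv_right_le_neg
    (U := fun τ => 2 * (lyapunov ξ f (y τ) - F * ‖G.laplacian‖ * ∫ s in 0..τ, ε s))
    ?_ (fun τ hτ => ((hasDerivWithinAt_lyapunov_comp hfc ξ (hyd τ hτ)).fun_sub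
      ((hI τ).hasDerivWithinAt.const_mul (F * ‖G.laplacian‖))).const_mul 2)
    (fun τ hτ => ?_) ?_ (fun τ _ => hξ.disagreement_nonneg _) hq
  · exact continuousOn_const.mul <| (hV.comp_continuousOn hyc).sub <|
      continuousOn_const.mul fun τ _ => (hI τ).continuousAt.continuousWithinAt
  · have hdissipate := hξ.two_mul_sum_mul_neg_laplacian_mulVec_add_le (f ∘ y τ) (e τ)
    have herror : ‖f ∘ y τ‖ * (‖G.laplacian‖ * ‖e τ‖) ≤ F * (‖G.laplacian‖ * ε τ) := by
      gcongr
      exacts [hF τ hτ, hye τ hτ]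
    simp only [Function.comp_apply] at hdissipate
    simp only [Pi.neg_apply]
    linarith
  · obtain ⟨C, hC⟩ := (isCompact_closedBall (0 : Fin n → ℝ) R).exists_bound_of_continuousOn
      hV.continuousOn
    refine ⟨2 * (-C - F * ‖G.laplacian‖ * ∫ s in Ioi 0, ε s), ?_⟩
    rintro _ ⟨τ, hτ, rfl⟩
    have hlower : -C ≤ lyapunov ξ f (y τ) :=
      (abs_le.1 (hC _ (mem_closedBall_zero_iff.2 (hR τ hτ)))).1
    beta_reduce
    gcongr
    exact hε.integral_le hτ

theorem tendsto_average (hy : IsPerturbedFlow G f ε ⊤ y e) (hf : Monotone f)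
    (hfc : Continuous f) (hε : IsErrorEnvelope ε) (hξ : G.IsLeftWeight ξ)
    (hG : G.StronglyConnected) (hinc : IsIncreasePoint f (ξ ⬝ᵥ y 0)) :
    Tendsto y atTop (𝓝 fun _ => ξ ⬝ᵥ y 0) := by
  obtain ⟨R, hR⟩ := hy.exists_norm_le hf hε
  have hball : ∀ᶠ τ in atTop, y τ ∈ Metric.closedBall (0 : Fin n → ℝ) R := by
    filter_upwards [eventually_ge_atTop 0] with τ hτ
    exact mem_closedBall_zero_iff.2 (hR τ ⟨hτ, EReal.coe_lt_top τ⟩)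
  refine (isCompact_closedBall 0 R).tendsto_nhds_of_unique_mapClusterPt hball fun z _ hz => ?_
  have hdis : G.disagreement ξ (f ∘ z) = 0 :=
    eq_of_mapClusterPt_of_tendsto_comp (φ := fun u => G.disagreement ξ (f ∘ u))
      ((G.continuous_disagreement ξ).comp (Pi.continuous_postcomp hfc)).continuousAt hz
      (hy.tendsto_disagreement hf hfc hε hξ)
  have hconst : Tendsto (fun τ => ξ ⬝ᵥ y τ) atTop (𝓝 (ξ ⬝ᵥ y 0)) :=
    tendsto_const_nhds.congr' <| by
      filter_upwards [eventually_ge_atTop 0] with τ hτ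
      exact (hy.dotProduct_eq hξ ⟨hτ, EReal.coe_lt_top τ⟩).symm
  have havg : ξ ⬝ᵥ z = ξ ⬝ᵥ y 0 :=
    eq_of_mapClusterPt_of_tendsto_comp (φ := fun u => ξ ⬝ᵥ u)
      (Continuous.continuousAt (by fun_prop)) hz hconst
  exact funext <| hinc.eq_of_sum_mul_eq (hξ.pos hG) hξ.sum_eq_one havg
    (hξ.eq_of_disagreement_eq_zero hG hdis)

end IsPerturbedFlow

end PerturbedFlow

section Triggering

variable {α β : Fin n → ℝ}

/-- The sum over all agents of the square roots `√α_i e^{-β_i τ / 2}` of the triggering thresholds: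
a common bound on the sampling errors. -/
noncomputable def triggerEnvelope (α β : Fin n → ℝ) (τ : ℝ) : ℝ :=
  ∑ i, √(α i) * Real.exp (-(β i / 2) * τ)

theorem triggerEnvelope_nonneg (α β : Fin n → ℝ) (τ : ℝ) : 0 ≤ triggerEnvelope α β τ :=
  Finset.sum_nonneg fun _ _ => by positivity

theorem isErrorEnvelope_triggerEnvelope (hβ : ∀ i, 0 < β i) :
    IsErrorEnvelope (triggerEnvelope α β) where
  continuous := by
    unfold triggerEnvelope
    fun_prop
  nonneg := triggerEnvelope_nonneg α β
  bddAbove := by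
    refine ⟨∑ i, √(α i), ?_⟩
    rintro _ ⟨τ, hτ, rfl⟩
    refine Finset.sum_le_sum fun i _ => mul_le_of_le_one_right (Real.sqrt_nonneg _) ?_
    exact Real.exp_le_one_iff.2 <|
      mul_nonpos_of_nonpos_of_nonneg (neg_nonpos.2 (half_pos (hβ i)).le) hτ
  integrableOn := integrable_finsetSum _ fun i _ =>
    (integrableOn_exp_mul_Ioi (neg_lt_zero.2 (half_pos (hβ i))) 0).const_mul _

theorem le_triggerEnvelope (hα : ∀ i, 0 ≤ α i) {i : Fin n} {τ c : ℝ}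
    (hc : c ^ 2 ≤ α i * Real.exp (-β i * τ)) : c ≤ triggerEnvelope α β τ := by
  have hsq : α i * Real.exp (-β i * τ) = (√(α i) * Real.exp (-(β i / 2) * τ)) ^ 2 := by
    rw [mul_pow, Real.sq_sqrt (hα i), ← Real.exp_nat_mul]
    congr 2
    push_cast
    ring
  calc c ≤ √(α i) * Real.exp (-(β i / 2) * τ) :=
        le_of_sq_le_sq (hc.trans_eq hsq) (by positivity)
    _ ≤ triggerEnvelope α β τ :=
        Finset.single_le_sum (f := fun j => √(α j) * Real.exp (-(β j / 2) * τ))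
          (fun j _ => by positivity) (Finset.mem_univ i)

variable {g : Fin p → ℝ → ℝ}

theorem continuous_output (hg : ∀ l, Continuous (g l)) : Continuous (output g) := by
  unfold output
  fun_prop

theorem threshold_le_of_isGreatest_admissibleTimes {y : ℝ → EuclideanSpace ℝ (Fin p)} {a b s r : ℝ}
    {T : EReal} (hg : ∀ l, Continuous (g l)) (hy : ContinuousWithinAt y (Ici r) r)
    (hr : IsGreatest (admissibleTimes g a b T y s) r) :
    a * Real.exp (-b * r) ≤ ‖output g (y s) - output g (y r)‖ ^ 2 := by
  obtain ⟨⟨hsr, hrT, hadm⟩, hmax⟩ := hr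
  by_contra! hlt
  have herr : ContinuousWithinAt (fun τ => ‖output g (y s) - output g (y τ)‖ ^ 2) (Ici r) r :=
    ((continuousWithinAt_const.sub
      ((continuous_output hg).continuousAt.comp_continuousWithinAt hy)).norm).pow 2
  have hthr : ContinuousWithinAt (fun τ => a * Real.exp (-b * τ)) (Ici r) r :=
    Continuous.continuousWithinAt (by fun_prop)
  have hT : ∀ᶠ τ : ℝ in 𝓝[≥] r, (τ : EReal) < T :=
    (continuous_coe_real_ereal.continuousAt.eventually_lt_const hrT).filter_mono nhdsWithin_le_nhds
  obtain ⟨u, hu, hsub⟩ := mem_nhdsGE_iff_exists_Icc_subset.1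
    ((herr.eventually_lt hthr hlt).and hT)
  have hur : r < u := hu
  have huadm : u ∈ admissibleTimes g a b T y s := by
    refine ⟨hsr.trans hur.le, (hsub (right_mem_Icc.2 hur.le)).2, fun τ hτ => ?_⟩
    rcases le_total τ r with hτr | hrτ
    · exact hadm τ ⟨hτ.1, hτr⟩
    · exact (hsub ⟨hrτ, hτ.2⟩).1.le
  exact hur.not_ge (hmax huadm)

end Triggering

namespace IsExecution

variable {G : WeightedDigraph n} {g : Fin p → ℝ → ℝ} {α β : Fin n → ℝ}
  {x : Fin n → ℝ → EuclideanSpace ℝ (Fin p)} {t : Fin n → ℕ → EReal} {i : Fin n} {k : ℕ} {τ : ℝ}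

theorem le_succ_of_nonneg (hx : IsExecution G g α β x t) (hk : 0 ≤ t i k) :
    t i k ≤ t i (k + 1) := by
  rcases eq_or_ne (t i k) ⊤ with htop | htop
  · exact (hx.next_top i k htop).symm ▸ le_top
  · have hs := (EReal.coe_toReal htop (EReal.bot_lt_zero.trans_le hk).ne').symm
    rcases hx.next i k _ hs with ⟨r, hr, hr'⟩ | ⟨-, htop'⟩
    · rw [hs, hr']
      exact EReal.coe_le_coe_iff.2 hr.1.1
    · exact htop'.symm ▸ le_top

theorem nonneg (hx : IsExecution G g α β x t) (i : Fin n) (k : ℕ) : 0 ≤ t i k := by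
  induction k with
  | zero => exact (hx.first i).ge
  | succ k ih => exact ih.trans (hx.le_succ_of_nonneg ih)

theorem monotone (hx : IsExecution G g α β x t) (i : Fin n) : Monotone (t i) :=
  monotone_nat_of_le_succ fun k => hx.le_succ_of_nonneg (hx.nonneg i k)

theorem coe_toReal (hx : IsExecution G g α β x t) (hk : t i k ≠ ⊤) :
    ((t i k).toReal : EReal) = t i k :=
  EReal.coe_toReal hk (EReal.bot_lt_zero.trans_le (hx.nonneg i k)).ne'

theorem finite_le (hx : IsExecution G g α β x t) (hτ : (τ : EReal) < horizon t) (i : Fin n) :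
    {k : ℕ | t i k ≤ τ}.Finite := by
  obtain ⟨m, hm⟩ := lt_iSup_iff.1 (hτ.trans_le (iInf_le _ i))
  exact (finite_Iio m).subset fun k hk => (hx.monotone i).reflect_lt (lt_of_le_of_lt hk hm)

theorem norm_error_sq_le (hx : IsExecution G g α β x t) (hτ : τ ∈ timeDomain (horizon t))
    (i : Fin n) :
    ‖output g (sampledState (x i) (t i) τ) - output g (x i τ)‖ ^ 2 ≤
      α i * Real.exp (-β i * τ) := by
  have hbdd := (hx.finite_le hτ.2 i).bddAbove
  have hle : t i (lastIndex (t i) τ) ≤ τ :=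
    Nat.sSup_mem (s := {k | t i k ≤ τ}) ⟨0, (hx.first i).trans_le (EReal.coe_nonneg.2 hτ.1)⟩ hbdd
  have hlt : (τ : EReal) < t i (lastIndex (t i) τ + 1) :=
    not_le.1 fun hmem => (Nat.lt_succ_self _).not_ge (le_csSup hbdd hmem)
  have hs := hx.coe_toReal (hle.trans_lt (EReal.coe_lt_top τ)).ne
  have hsτ : (t i (lastIndex (t i) τ)).toReal ≤ τ := EReal.coe_le_coe_iff.1 (hs.trans_le hle)
  rcases hx.next i _ _ hs.symm with ⟨r, hr, hr'⟩ | ⟨hadm, -⟩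
  · exact hr.1.2.2 τ ⟨hsτ, EReal.coe_le_coe_iff.1 (hr' ▸ hlt.le)⟩
  · exact (hadm τ hsτ hτ.2).2.2 τ ⟨hsτ, le_rfl⟩

theorem isPerturbedFlow (hx : IsExecution G g α β x t) (hα : ∀ i, 0 ≤ α i) (l : Fin p) :
    IsPerturbedFlow G (g l) (triggerEnvelope α β) (horizon t) (fun τ i => x i τ l)
      (fun τ i => g l (sampledState (x i) (t i) τ l) - g l (x i τ l)) where
  continuousOn := continuousOn_pi.2 fun i =>
    (EuclideanSpace.proj l).continuous.comp_continuousOn (hx.continuousOn i)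
  deriv_right τ hτ := by
    refine hasDerivWithinAt_pi.2 fun i => ?_
    have hinput : (-(G.laplacian *ᵥ (g l ∘ (fun i => x i τ l) +
        fun i => g l (sampledState (x i) (t i) τ l) - g l (x i τ l)))) i =
          controlInput G g x t i τ l := by
      simp [controlInput, output, Matrix.mulVec, dotProduct]
    rw [hinput]
    exact (EuclideanSpace.proj l).hasFDerivAt.comp_hasDerivWithinAt τ
      (hx.deriv_right i τ hτ.1 hτ.2)
  norm_error_le τ hτ := (pi_norm_le_iff_of_nonneg (triggerEnvelope_nonneg α β τ)).2 fun i =>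
    (PiLp.norm_apply_le (output g (sampledState (x i) (t i) τ) - output g (x i τ)) l).trans
      (le_triggerEnvelope hα (hx.norm_error_sq_le hτ i))

theorem uniformContinuousOn_output (hx : IsExecution G g α β x t) (hgc : ∀ l, Continuous (g l))
    (hgm : ∀ l, Monotone (g l)) (hα : ∀ i, 0 ≤ α i) (hβ : ∀ i, 0 < β i) (i : Fin n) :
    UniformContinuousOn (fun τ => output g (x i τ)) (timeDomain (horizon t)) := by
  have hcoord (l : Fin p) : UniformContinuousOn (fun τ => g l (x i τ l)) (timeDomain (horizon t)) :=
    (hx.isPerturbedFlow hα l).uniformContinuousOn_comp (φ := fun u => g l (u i)) (hgm l) (hgc l)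
      (isErrorEnvelope_triggerEnvelope hβ) ((hgc l).comp (continuous_apply i))
  simp only [uniformContinuousOn_iff_restrict] at hcoord ⊢
  exact (PiLp.uniformContinuous_toLp 2 _).comp (uniformContinuous_pi.2 hcoord)

theorem exists_dwell_time (hx : IsExecution G g α β x t) (hgc : ∀ l, Continuous (g l))
    (hgm : ∀ l, Monotone (g l)) (hα : ∀ i, 0 < α i) (hβ : ∀ i, 0 < β i) {T : ℝ}
    (hT : horizon t ≤ T) (i : Fin n) :
    ∃ δ > 0, ∀ k (s r : ℝ), t i k = s → t i (k + 1) = r → s + δ ≤ r := by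
  have hη : 0 < α i * Real.exp (-β i * T) := mul_pos (hα i) (Real.exp_pos _)
  obtain ⟨δ, hδ, hunif⟩ := Metric.uniformContinuousOn_iff.1
    (hx.uniformContinuousOn_output hgc hgm (fun i => (hα i).le) hβ i) _ (Real.sqrt_pos.2 hη)
  refine ⟨δ, hδ, fun k s r hs hr => ?_⟩
  rcases hx.next i k s hs with ⟨r', hmax, hr'⟩ | ⟨-, htop⟩
  · obtain rfl : r = r' := EReal.coe_injective (hr.symm.trans hr')
    have hs₀ : 0 ≤ s := EReal.coe_nonneg.1 (hs ▸ hx.nonneg i k)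
    have hr_mem : r ∈ timeDomain (horizon t) := ⟨hs₀.trans hmax.1.1, hmax.1.2.1⟩
    have hs_mem := Icc_subset_timeDomain hs₀ hr_mem (left_mem_Icc.2 hmax.1.1)
    have hrT : r ≤ T := EReal.coe_le_coe_iff.1 (hr_mem.2.le.trans hT)
    by_contra! hlt
    have hdist : dist s r < δ := by
      rw [dist_comm, Real.dist_eq, abs_of_nonneg (sub_nonneg.2 hmax.1.1)]
      linarith
    have herr := hunif s hs_mem r hr_mem hdist
    rw [dist_eq_norm, Real.lt_sqrt (norm_nonneg _)] at herr
    have hthr := threshold_le_of_isGreatest_admissibleTimes hgc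
      (hx.deriv_right i r hr_mem.1 hr_mem.2).continuousWithinAt hmax
    have hanti : α i * Real.exp (-β i * T) ≤ α i * Real.exp (-β i * r) :=
      mul_le_mul_of_nonneg_left (Real.exp_le_exp.2
        (mul_le_mul_of_nonpos_left hrT (neg_nonpos.2 (hβ i).le))) (hα i).le
    exact (herr.trans_le (hanti.trans hthr)).false
  · exact absurd (hr.symm.trans htop) (EReal.coe_ne_top r)

theorem horizon_eq_top (hx : IsExecution G g α β x t) (hgc : ∀ l, Continuous (g l))
    (hgm : ∀ l, Monotone (g l)) (hα : ∀ i, 0 < α i) (hβ : ∀ i, 0 < β i) : horizon t = ⊤ := by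
  by_contra hne
  obtain ⟨i, hi⟩ := iInf_lt_top.1 (lt_top_iff_ne_top.2 hne)
  have htop (k : ℕ) : t i k ≠ ⊤ := ((le_iSup (t i) k).trans_lt hi).ne
  have hsup : ((⨆ k, t i k).toReal : EReal) = ⨆ k, t i k := EReal.coe_toReal hi.ne
    (EReal.bot_lt_zero.trans_le ((hx.nonneg i 0).trans (le_iSup (t i) 0))).ne'
  obtain ⟨δ, hδ, hdwell⟩ := hx.exists_dwell_time hgc hgm hα hβ ((iInf_le _ i).trans_eq hsup.symm) i
  have hgrow (k : ℕ) : k * δ ≤ (t i k).toReal := by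
    induction k with
    | zero => simp [hx.first i]
    | succ k ih =>
      push_cast
      linarith [hdwell k _ _ (hx.coe_toReal (htop k)).symm (hx.coe_toReal (htop (k + 1))).symm]
  obtain ⟨k, hk⟩ := exists_nat_gt ((⨆ k, t i k).toReal / δ)
  have hle : (t i k).toReal ≤ (⨆ k, t i k).toReal :=
    EReal.coe_le_coe_iff.1 <| by
      rw [hx.coe_toReal (htop k), hsup]
      exact le_iSup (t i) k
  exact ((div_lt_iff₀ hδ).1 hk).not_ge ((hgrow k).trans hle)

theorem noZeno (hx : IsExecution G g α β x t) (hgc : ∀ l, Continuous (g l))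
    (hgm : ∀ l, Monotone (g l)) (hα : ∀ i, 0 < α i) (hβ : ∀ i, 0 < β i) : NoZeno t :=
  have htop := hx.horizon_eq_top hgc hgm hα hβ
  ⟨htop, fun i S => hx.finite_le (htop ▸ EReal.coe_lt_top S) i⟩

end IsExecution

theorem weightedAverage_apply (ξ : Fin n → ℝ) (x : Fin n → ℝ → EuclideanSpace ℝ (Fin p)) (τ : ℝ)
    (l : Fin p) : weightedAverage ξ x τ l = ξ ⬝ᵥ fun i => x i τ l := by
  simp [weightedAverage, dotProduct]

end EventTriggered

theorem theorem1_general {n p : ℕ} (G : EventTriggered.WeightedDigraph n) (hG : G.StronglyConnected)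
    (g : Fin p → ℝ → ℝ) (hgc : ∀ l, Continuous (g l)) (hgm : ∀ l, Monotone (g l))
    (α β : Fin n → ℝ) (hα : ∀ i, 0 < α i) (hβ : ∀ i, 0 < β i)
    (x : Fin n → ℝ → EuclideanSpace ℝ (Fin p)) (t : Fin n → ℕ → EReal)
    (hx : EventTriggered.IsExecution G g α β x t) :
    EventTriggered.NoZeno t ∧
      ∀ ξ : Fin n → ℝ, G.IsLeftWeight ξ →
        (∀ l, EventTriggered.IsIncreasePoint (g l) (EventTriggered.weightedAverage ξ x 0 l)) →
          ∀ i, Tendsto (x i) atTop (𝓝 (EventTriggered.weightedAverage ξ x 0)) := by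
  have hZeno := hx.noZeno hgc hgm hα hβ
  refine ⟨hZeno, fun ξ hξ hinc i => ?_⟩
  have hcoord (l : Fin p) :
      Tendsto (fun τ => x i τ l) atTop (𝓝 (EventTriggered.weightedAverage ξ x 0 l)) := by
    have hflow := hZeno.1 ▸ hx.isPerturbedFlow (fun i => (hα i).le) l
    have hincl := hinc l
    rw [EventTriggered.weightedAverage_apply] at hincl ⊢
    exact tendsto_pi_nhds.1 (hflow.tendsto_average (hgm l) (hgc l)
      (EventTriggered.isErrorEnvelope_triggerEnvelope hβ) hξ hG hincl) i
  exact ((PiLp.continuous_toLp 2 _).tendsto _).comp (tendsto_pi_nhds.2 hcoord)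

theorem theorem1 {n p : ℕ} (G : EventTriggered.WeightedDigraph n) (hG : G.StronglyConnected)
    (g : Fin p → ℝ → ℝ) (h : ℝ) (hh : 0 < h) (hg : EventTriggered.OutputAssumption g h)
    (α β : Fin n → ℝ) (hα : ∀ i, 0 < α i) (hβ : ∀ i, 0 < β i)
    (x : Fin n → ℝ → EuclideanSpace ℝ (Fin p)) (t : Fin n → ℕ → EReal)
    (hx : EventTriggered.IsExecution G g α β x t) :
    EventTriggered.NoZeno t ∧
      ∀ ξ : Fin n → ℝ, G.IsLeftWeight ξ →
        (∀ l, |EventTriggered.weightedAverage ξ x 0 l| ≤ h) →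
          ∀ i, Filter.Tendsto (x i) Filter.atTop
            (nhds (EventTriggered.weightedAverage ξ x 0)) :=
  (theorem1_general G hG g hg.continuous hg.monotone α β hα hβ x t hx).imp_right
    fun hcons ξ hξ havg => hcons ξ hξ fun l =>
      EventTriggered.isIncreasePoint_of_strictMonoOn_Icc (neg_lt_self hh) (hg.monotone l)
        (hg.strictMonoOn l) (abs_le.1 (havg l))
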